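/- Let $H_{\mathbb C}$ be an infinite-dimensional complex Hilbert space, $\Omega(a,b)=\operatorname{Im}\langle a,b\rangle$, and let $\mathcal H_\Omega=H_{\mathbb C}\times\mathbb R$ be the infinite-dimensional Heisenberg group, with group law $(a,t)(a',t')=(a+a',\,t+t'+2\,\Omega(a,a'))$ and the product topology. Put $$N(a,t)=\sqrt{\sqrt{\|a\|^4+t^2}+\|a\|^2},\qquad d_N(g,h)=N(gh^{-1}).$$ Then $N$ is a group norm on $\mathcal H_\Omega$ (that is, $N(e)=0$, $N(g^{-1})=N(g)$, $N(gh)\le N(g)+N(h)$, and $N(g)=0$ only for $g=e$), $d_N$ is a right-invariant metric on $\mathcal H_\Omega$, and: 1. $d_N$ is conditionally of negative type: it is a continuous real-valued kernel with $d_N(x,x)=0$ and $d_N(x,y)=d_N(y,x)$ for all $x,y$, and $\sum_{i=1}^n\sum_{j=1}^n c_ic_j\,d_N(x_i,x_j)\le 0$ for all $n\in\mathbb N$, all $x_1,\dots,x_n\in\mathcal H_\Omega$ and all $c_1,\dots,c_n\in\mathbb R$ with $\sum_i c_i=0$. 2. There are a real Hilbert space $H$ and a map $T:\mathcal H_\Omega\to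 H$ with $\|T(g)-T(h)\|=\sqrt{d_N(g,h)}$ for all $g,h$, that is, an isometric embedding of $(\mathcal H_\Omega,\sqrt{d_N})$ into $H$, such that for every origin $q\in\mathcal H_\Omega$ the map $T$, extended by $T(\infty)=\infty$, is an asymptotic-Möbius map (AM-map) at infinity from $(\mathcal H_\Omega\cup\{\infty\},d_N,q,\infty)$ to $(H\cup\{\infty\},\|\cdot-\cdot\|,T(q),\infty)$. Here a map $f:(X\cup\{\infty\},q,\infty)\to(Y\cup\{\infty\},q',\infty)$ with $f(q)=q'$, $f(\infty)=\infty$, where $(X,d)$ and $(Y,d')$ are unbounded quasimetric spaces (the distance functions are symmetric and comparable to a metric up to a multiplicative constant), is an AM-map at infinity if there are a nondecreasing $u:[0,\infty)\to\mathbb R$ with $\limsup_{r\to\infty}u(r)/r=0$ and a homeomorphism $\eta:[0,\infty)\to[0,\infty)$ such that $$[f(x),f(y),f(z),f(w)]<\eta([x,y,z,w])$$ for all $x,y,z,w\in X\cup\{\infty\}$ that are pairwise separated by $u$ and for which $[x,y,z,w]$ is defined (the inequality includes that the left-hand side is defined). Two points $x,y\in X$ are separated by $u$ if $d(x,y)>u(d(x,q)+d(q,y))$,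 and every $x\in X$ is separated from $\infty$. The cross ratio $[x,y,z,w]=\frac{d(x,z)\,d(y,w)}{d(x,w)\,d(y,z)}$ is defined for $x\ne w$, $y\ne z$; it is $0$ if $x=z$ or $y=w$, and otherwise factors containing $\infty$ are omitted. -/

import Mathlib

open Filter Topology
open scoped NNReal

universe u

/-! ### The Heisenberg group of a complex inner product space -/

/-- The underlying set of the Heisenberg group over `E`: pairs `(a, t)` with `a ∈ E`, `t ∈ ℝ`. -/
@[ext]
structure Heis (E : Type u) where
  /-- the horizontal component -/
  a : E
  /-- the central component -/
  t : ℝ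

namespace Heis

variable {E : Type u} [NormedAddCommGroup E]

instance : One (Heis E) := ⟨⟨0, 0⟩⟩

instance : Inv (Heis E) := ⟨fun g => ⟨-g.a, -g.t⟩⟩

@[simp] theorem one_a : (1 : Heis E).a = 0 := rfl
@[simp] theorem one_t : (1 : Heis E).t = 0 := rfl
@[simp] theorem inv_a (g : Heis E) : (g⁻¹).a = -g.a := rfl
@[simp] theorem inv_t (g : Heis E) : (g⁻¹).t = -g.t := rfl

/-- The Heisenberg group carries the topology of `E × ℝ`. -/
instance : TopologicalSpace (Heis E) :=
  TopologicalSpace.induced (fun g : Heis E => (g.a, g.t)) inferInstance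

/-- `N(a, t) = √(√(‖a‖⁴ + t²) + ‖a‖²)`. -/
noncomputable def N (g : Heis E) : ℝ :=
  Real.sqrt (Real.sqrt (‖g.a‖ ^ 4 + g.t ^ 2) + ‖g.a‖ ^ 2)

variable [InnerProductSpace ℂ E]

/-- The symplectic form `Ω(a, b) = Im ⟨a, b⟩`. -/
noncomputable def Omega (a b : E) : ℝ := (inner ℂ a b).im

/-- The group law `(a, t)(a', t') = (a + a', t + t' + 2 Ω(a, a'))`. -/
noncomputable instance : Mul (Heis E) := ⟨fun g h => ⟨g.a + h.a, g.t + h.t + 2 * Omega g.a h.a⟩⟩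

@[simp] theorem mul_a (g h : Heis E) : (g * h).a = g.a + h.a := rfl
@[simp] theorem mul_t (g h : Heis E) : (g * h).t = g.t + h.t + 2 * Omega g.a h.a := rfl

noncomputable instance : Group (Heis E) where
  mul_assoc g h k := by
    ext
    · simp [add_assoc]
    · simp only [mul_t, mul_a, Omega, inner_add_left, inner_add_right, Complex.add_im]
      ring
  one_mul g := by ext <;> simp [Omega]
  mul_one g := by ext <;> simp [Omega]
  inv_mul_cancel g := by
    have h : (inner ℂ g.a g.a).im = 0 := inner_self_im (𝕜 := ℂ) g.a
    ext
    · simp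
    · simp only [mul_t, inv_a, inv_t, one_t, Omega, inner_neg_left, Complex.neg_im, h]
      ring

/-- `d_N(g, h) = N(g h⁻¹)`. -/
noncomputable def dN (g h : Heis E) : ℝ := N (g * h⁻¹)

end Heis

/-! ### Kernels conditionally of negative type -/

/-- A continuous real kernel `K` on a topological space that is conditionally of negative type. -/
structure IsCondNegType {X : Type*} [TopologicalSpace X] (K : X → X → ℝ) : Prop where
  continuous : Continuous fun p : X × X => K p.1 p.2
  diag : ∀ x, K x x = 0
  symm : ∀ x y, K y x = K x y
  sum_nonpos : ∀ (n : ℕ) (x : Fin n → X) (c : Fin n → ℝ), ∑ i, c i = 0 →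
    ∑ i, ∑ j, c i * c j * K (x i) (x j) ≤ 0

/-! ### Asymptotic-Möbius maps at infinity

An unbounded quasimetric space with a point at infinity is given by its set `X` of finite points
and the (finite) quasimetric `d` on it; the whole space is `OnePoint X`, that is `X ∪ {∞}`, where
`∞` has distance `∞` to every point of `X`. Only the underlying set of `OnePoint X` is used. -/

/-- `d` is a metric on the set `X`. -/
def IsMetric {X : Type*} (d : X → X → ℝ) : Prop :=
  ∃ m : MetricSpace X, ∀ x y, m.dist x y = d x y

/-- `d` is symmetric and comparable to a metric up to a multiplicative constant. -/
def IsQuasimetric {X : Type*} (d : X → X → ℝ) : Prop :=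
  (∀ x y, d x y = d y x) ∧
  ∃ K : ℝ, 0 < K ∧ ∃ ρ : X → X → ℝ, IsMetric ρ ∧
    ∀ x y, 1 / K * ρ x y ≤ d x y ∧ d x y ≤ K * ρ x y

/-- The distance of two points, replaced by `1` (that is, omitted from a product or quotient)
if one of the points is `∞`. -/
def distFactor {X : Type*} (d : X → X → ℝ) : OnePoint X → OnePoint X → ℝ
  | some x, some y => d x y
  | _, _ => 1

open Classical in
/-- The cross ratio `[x, y, z, w] = d(x,z) d(y,w) / (d(x,w) d(y,z))`, for `x ≠ w` and `y ≠ z`;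
it is `0` if `x = z` or `y = w`, and otherwise the factors containing `∞` are omitted. -/
noncomputable def crossRatio {X : Type*} (d : X → X → ℝ) (x y z w : OnePoint X) : ℝ :=
  if x = z ∨ y = w then 0
  else distFactor d x z * distFactor d y w / (distFactor d x w * distFactor d y z)

/-- An admissible gauge: nondecreasing on `[0, ∞)` and of sublinear growth. (For a nondecreasing
`u` the lower limit of `u r / r` is nonnegative, so `limsup = 0` says that the limit is `0`.) -/
def IsAdmissibleGauge (u : ℝ≥0 → ℝ) : Prop :=
  Monotone u ∧ Tendsto (fun r : ℝ≥0 => u r / r) atTop (𝓝 0)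

/-- `x` and `y` are separated by `u` at infinity, with respect to the origin `q`:
`d(x, y) > u(d(x, q) + d(q, y))`. Every finite point is separated from `∞`. -/
def Separated {X : Type*} (d : X → X → ℝ) (q : X) (u : ℝ≥0 → ℝ) : OnePoint X → OnePoint X → Prop
  | some x, some y => u (d x q + d q y).toNNReal < d x y
  | some _, none => True
  | none, some _ => True
  | none, none => False

/-- `f : (X ∪ {∞}, q, ∞) → (Y ∪ {∞}, q', ∞)` is an asymptotic-Möbius map at infinity between
unbounded doubly pointed quasimetric spaces. The inequality between the cross ratios is required
for all pairwise separated quadruples for which the cross ratio in the source is defined, and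
includes that the cross ratio in the target is defined. -/
structure IsAMMapAtInfinity {X Y : Type*} (dX : X → X → ℝ) (q : X) (dY : Y → Y → ℝ) (q' : Y)
    (f : OnePoint X → OnePoint Y) : Prop where
  quasimetric_source : IsQuasimetric dX
  quasimetric_target : IsQuasimetric dY
  unbounded_source : ∀ C : ℝ, ∃ x y, C < dX x y
  unbounded_target : ∀ C : ℝ, ∃ x y, C < dY x y
  map_origin : f (q : OnePoint X) = (q' : OnePoint Y)
  map_infty : f OnePoint.infty = OnePoint.infty
  crossRatio_lt : ∃ (u : ℝ≥0 → ℝ) (η : ℝ≥0 ≃ₜ ℝ≥0), IsAdmissibleGauge u ∧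
    ∀ x y z w : OnePoint X, [x, y, z, w].Pairwise (Separated dX q u) → x ≠ w → y ≠ z →
      f x ≠ f w ∧ f y ≠ f z ∧
        crossRatio dY (f x) (f y) (f z) (f w) < (η (crossRatio dX x y z w).toNNReal : ℝ)

/-!
Put `ζ(a, t) = ‖a‖² + it`, so that `N = √2 Re √ζ` with the principal branch. The group law gives
`ζ(g h⁻¹) = ζ(g) + conj ζ(h) - 2⟪a, b⟫` for `g = (a, s)` and `h = (b, t)`. For `r ≥ 0` the kernel
`exp(-r ζ(g h⁻¹))` is therefore a rank-one positive kernel times the exponential of a Gram kernel,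
hence positive semidefinite by the Schur product theorem. Integrating `1 - exp(-ζ x²)` against
`x⁻² dx` over `(0, ∞)` yields `√π √ζ`, so `d_N = √2 Re √ζ(g h⁻¹)` is conditionally of negative type.
The reproducing kernel Hilbert space of the kernel centred at the identity then carries an isometric
embedding of `√d_N`. It raises every distance, hence every cross ratio, to the power `1/2`, so it is
an AM-map with `u = 0` and `η(t) = (2t)^(1/2)`; the factor `2` makes the inequality strict.
-/

section PositiveSemidefinite

open scoped ComplexOrder Matrix ComplexConjugate

theorem isClosed_setOf_posSemidef (ι 𝕜 : Type*) [RCLike 𝕜] :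
    IsClosed {M : Matrix ι ι 𝕜 | M.PosSemidef} := by
  have hermitian : IsClosed {M : Matrix ι ι 𝕜 | M.IsHermitian} :=
    isClosed_eq continuous_id.matrix_conjTranspose continuous_id
  have nonneg (v : ι →₀ 𝕜) : IsClosed {M : Matrix ι ι 𝕜 |
      0 ≤ v.sum fun i a => v.sum fun j b => star a * M i j * b} :=
    isClosed_le continuous_const <| continuous_finsetSum _ fun i _ => continuous_finsetSum _
      fun j _ => (continuous_const.mul (continuous_id.matrix_elem i j)).mul continuous_const
  simpa only [Matrix.PosSemidef, Set.ofPred_and, Set.ofPred_forall] using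
    hermitian.inter (isClosed_iInter nonneg)

variable {ι : Type*} [Finite ι]

theorem posSemidef_map_pow {𝕜 : Type*} [RCLike 𝕜] {M : Matrix ι ι 𝕜} (hM : M.PosSemidef) (n : ℕ) :
    (M.map (· ^ n)).PosSemidef := by
  induction n with
  | zero =>
    have ones : M.map (· ^ 0) = Matrix.vecMulVec 1 (star 1) := by
      ext i j
      simp [Matrix.vecMulVec_apply]
    exact ones ▸ Matrix.posSemidef_vecMulVec_self_star 1
  | succ n ih =>
    have step : M.map (· ^ (n + 1)) = M.map (· ^ n) ⊙ M := by
      ext i j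
      exact pow_succ _ _
    exact step ▸ ih.hadamard hM

theorem posSemidef_map_exp {M : Matrix ι ι ℂ} (hM : M.PosSemidef) :
    (M.map Complex.exp).PosSemidef := by
  have partialSums (s : Finset ℕ) :
      (∑ n ∈ s, (n.factorial : ℂ)⁻¹ • M.map (· ^ n)).PosSemidef :=
    Matrix.posSemidef_sum s fun n _ =>
      (posSemidef_map_pow hM n).smul (inv_nonneg.2 n.factorial.cast_nonneg)
  have hasSum_exp : HasSum (fun n : ℕ => (n.factorial : ℂ)⁻¹ • M.map (· ^ n))
      (M.map Complex.exp) := by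
    refine Pi.hasSum.2 fun i => Pi.hasSum.2 fun j => ?_
    simpa only [Matrix.smul_apply, Matrix.map_apply, Complex.exp_eq_exp_ℂ] using
      NormedSpace.exp_series_hasSum_exp' (𝕂 := ℂ) (M i j)
  exact (isClosed_setOf_posSemidef ι ℂ).mem_of_tendsto hasSum_exp (Eventually.of_forall partialSums)

theorem posSemidef_exp_add_conj_add {M : Matrix ι ι ℂ} (hM : M.PosSemidef) (p : ι → ℂ) :
    (Matrix.of fun i j => Complex.exp (p i + conj (p j) + M i j)).PosSemidef := by
  have factorization : (Matrix.of fun i j => Complex.exp (p i + conj (p j) + M i j)) =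
      Matrix.vecMulVec (Complex.exp ∘ p) (star (Complex.exp ∘ p)) ⊙ M.map Complex.exp := by
    ext i j
    simp [Matrix.vecMulVec_apply, Complex.exp_add, Complex.exp_conj]
  exact factorization ▸
    (Matrix.posSemidef_vecMulVec_self_star _).hadamard (posSemidef_map_exp hM)

theorem posSemidef_map_re {M : Matrix ι ι ℂ} (hM : M.PosSemidef) :
    (M.map Complex.re).PosSemidef := by
  have := Fintype.ofFinite ι
  refine .of_dotProduct_mulVec_nonneg ?_ fun c => ?_
  · ext i j
    simpa using congrArg Complex.re (hM.1.apply i j)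
  · have h := (Complex.le_def.1 (hM.dotProduct_mulVec_nonneg fun i => (c i : ℂ))).1
    simpa [dotProduct, Matrix.mulVec, Finset.mul_sum] using h

theorem sum_mul_mul_one_sub_nonpos {ι : Type*} [Fintype ι] {M : Matrix ι ι ℝ}
    (hM : M.PosSemidef) {c : ι → ℝ} (hc : ∑ i, c i = 0) :
    ∑ i, ∑ j, c i * c j * (1 - M i j) ≤ 0 := by
  have hsq : ∑ i, ∑ j, c i * c j = 0 := by rw [← Finset.sum_mul_sum, hc, zero_mul]
  have hform : c ⬝ᵥ M *ᵥ c = ∑ i, ∑ j, c i * c j * M i j := by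
    simp only [dotProduct, Matrix.mulVec, Finset.mul_sum]
    exact Finset.sum_congr rfl fun i _ => Finset.sum_congr rfl fun j _ => by ring
  simp only [mul_sub, mul_one, Finset.sum_sub_distrib, hsq, ← hform, zero_sub, neg_nonpos]
  exact hM.dotProduct_mulVec_nonneg c

end PositiveSemidefinite

section Embedding

open scoped ComplexOrder

theorem exists_hilbert_inner_eq_of_posSemidef.{v, w} {𝕜 : Type v} {X : Type w} [RCLike 𝕜]
    {k : Matrix X X 𝕜} (hk : k.PosSemidef) :
    ∃ (H : Type (max v w)) (_ : NormedAddCommGroup H) (_ : InnerProductSpace 𝕜 H)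
      (_ : CompleteSpace H) (T : X → H), ∀ x y, inner 𝕜 (T x) (T y) = k x y := by
  let M : Matrix X X (𝕜 →L[𝕜] 𝕜) := Matrix.of fun x y => k x y • ContinuousLinearMap.id 𝕜 𝕜
  have hM : M.PosSemidef := by
    have tfae : M.PosSemidef ↔ M.IsHermitian ∧ ∀ v : X →₀ 𝕜,
        0 ≤ RCLike.re (v.sum fun x w => v.sum fun x' w' => inner 𝕜 (M x' x w) w') :=
      RKHS.posSemidef_tfae.out 0 2
    have inner_apply (x x' : X) (w w' : 𝕜) : inner 𝕜 (M x' x w) w' = star w * k x x' * w' := by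
      simp [M, ← hk.1.apply x x', mul_comm]
    refine tfae.2 ⟨?_, fun v => ?_⟩
    · ext x y
      simp [M, ← hk.1.apply x y, ContinuousLinearMap.star_eq_adjoint,
        ContinuousLinearMap.adjoint_id]
    · simpa only [inner_apply] using (RCLike.nonneg_iff.1 (hk.2 v)).1
  have : Fact M.PosSemidef := ⟨hM⟩
  refine ⟨RKHS.OfKernel M, inferInstance, inferInstance, inferInstance,
    fun x => RKHS.kerFun (RKHS.OfKernel M) x 1, fun x y => ?_⟩
  rw [← RKHS.kernel_inner, RKHS.OfKernel.kernel_ofKernel]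
  simpa [M] using hk.1.apply x y

end Embedding

namespace IsCondNegType

variable {X : Type*} [TopologicalSpace X] {K : X → X → ℝ}

theorem sum_nonpos_of_fintype {ι : Type*} [Fintype ι] (hK : IsCondNegType K)
    (x : ι → X) {c : ι → ℝ} (hc : ∑ i, c i = 0) :
    ∑ i, ∑ j, c i * c j * K (x i) (x j) ≤ 0 := by
  let e := (Fintype.equivFin ι).symm
  calc ∑ i, ∑ j, c i * c j * K (x i) (x j)
      = ∑ i, ∑ j, c (e i) * c (e j) * K (x (e i)) (x (e j)) :=
        (e.sum_comp _).symm.trans <| Finset.sum_congr rfl fun i _ => (e.sum_comp _).symm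
    _ ≤ 0 := hK.sum_nonpos _ (x ∘ e) (c ∘ e) ((e.sum_comp c).trans hc)

theorem sum_centered_nonneg {ι : Type*} [Fintype ι] (hK : IsCondNegType K) (o : X) (x : ι → X)
    (c : ι → ℝ) :
    0 ≤ ∑ i, ∑ j, c i * ((K (x i) o + K (x j) o - K (x i) (x j)) / 2) * c j := by
  set m := ∑ i, c i with hm
  set p := ∑ i, c i * K (x i) o with hp
  -- Adding the point `o` with weight `-m` makes the total weight vanish.
  have hneg : ∑ i, ∑ j, c i * c j * K (x i) (x j) - 2 * (m * p) ≤ 0 := by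
    have h := hK.sum_nonpos_of_fintype (fun i : Option ι => i.elim o x)
      (c := fun i => i.elim (-m) c) (by simp [Fintype.sum_option, m])
    simp only [Fintype.sum_option, Option.elim, hK.diag, hK.symm _ o, Finset.sum_add_distrib,
      mul_comm _ (-m), mul_assoc (-m), ← Finset.mul_sum, ← hp] at h
    linarith
  have hrow : ∑ i, ∑ j, c i * c j * K (x j) o = m * p := by
    simp only [hm, hp, Finset.sum_mul_sum, mul_assoc]
  have hcol : ∑ i, ∑ j, c i * c j * K (x i) o = m * p := by
    rw [Finset.sum_comm, ← hrow]
    simp only [mul_comm (c _) (c _)]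
  calc 0 ≤ (m * p + m * p - ∑ i, ∑ j, c i * c j * K (x i) (x j)) / 2 := by linarith
    _ = ∑ i, ∑ j,
        (c i * c j * K (x i) o + c i * c j * K (x j) o - c i * c j * K (x i) (x j)) / 2 := by
      simp only [← Finset.sum_div, Finset.sum_sub_distrib, Finset.sum_add_distrib, hrow, hcol]
    _ = _ := Finset.sum_congr rfl fun i _ => Finset.sum_congr rfl fun j _ => by ring

theorem posSemidef_centered (hK : IsCondNegType K) (o : X) :
    (Matrix.of fun x y => (K x o + K y o - K x y) / 2).PosSemidef := by
  refine ⟨?_, fun v => ?_⟩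
  · ext x y
    simp [hK.symm x y, add_comm (K x o)]
  · refine (hK.sum_centered_nonneg o ((↑) : v.support → X) fun i => v i).trans_eq ?_
    simp only [Finsupp.sum, ← Finset.sum_coe_sort v.support, Matrix.of_apply, star_trivial]

theorem exists_embedding {X : Type u} [TopologicalSpace X] {K : X → X → ℝ}
    (hK : IsCondNegType K) (o : X) :
    ∃ (H : Type u) (_ : NormedAddCommGroup H) (_ : InnerProductSpace ℝ H) (_ : CompleteSpace H)
      (T : X → H), ∀ x y, dist (T x) (T y) = √(K x y) := by
  obtain ⟨H, i₁, i₂, i₃, T, hT⟩ := exists_hilbert_inner_eq_of_posSemidef (hK.posSemidef_centered o)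
  refine ⟨H, i₁, i₂, i₃, T, fun x y => ?_⟩
  have hsq : dist (T x) (T y) ^ 2 = K x y := by
    rw [dist_eq_norm, norm_sub_sq_real, ← real_inner_self_eq_norm_sq, ← real_inner_self_eq_norm_sq]
    simp only [hT, Matrix.of_apply, hK.diag]
    ring
  rw [← hsq, Real.sqrt_sq dist_nonneg]

end IsCondNegType

section SquareRoot

open MeasureTheory

theorem norm_one_sub_cexp_neg_le_norm {z : ℂ} (hz : 0 ≤ z.re) : ‖1 - Complex.exp (-z)‖ ≤ ‖z‖ := by
  have hderiv (w : ℂ) : HasDerivAt (fun w => Complex.exp (-w)) (-Complex.exp (-w)) w := by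
    simpa using (hasDerivAt_neg w).cexp
  have hbound : ∀ w ∈ {w : ℂ | 0 ≤ w.re}, ‖-Complex.exp (-w)‖ ≤ 1 := fun w hw => by
    simpa [Complex.norm_exp] using hw
  simpa using (convex_halfSpace_re_ge 0).norm_image_sub_le_of_norm_hasDerivWithin_le
    (fun w _ => (hderiv w).hasDerivWithinAt) hbound hz (y := 0) (by simp)

variable {b : ℂ}

theorem norm_one_sub_cexp_neg_mul_sq_le_two (hb : 0 ≤ b.re) (x : ℝ) :
    ‖1 - Complex.exp (-b * x ^ 2)‖ ≤ 2 := by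
  have hre : 0 ≤ b.re * x ^ 2 := mul_nonneg hb (sq_nonneg x)
  calc ‖1 - Complex.exp (-b * x ^ 2)‖ ≤ ‖(1 : ℂ)‖ + ‖Complex.exp (-b * x ^ 2)‖ := norm_sub_le _ _
    _ ≤ 1 + 1 := by simpa [Complex.norm_exp, ← Complex.ofReal_pow] using hre
    _ = 2 := one_add_one_eq_two

theorem norm_one_sub_cexp_neg_mul_sq_le_norm (hb : 0 ≤ b.re) (x : ℝ) :
    ‖1 - Complex.exp (-b * x ^ 2)‖ ≤ ‖b‖ * x ^ 2 := by
  have hre : 0 ≤ (b * x ^ 2).re := by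
    simpa [← Complex.ofReal_pow] using mul_nonneg hb (sq_nonneg x)
  simpa using norm_one_sub_cexp_neg_le_norm hre

theorem integrableOn_one_sub_cexp_neg_mul_sq_div_sq (hb : 0 ≤ b.re) :
    IntegrableOn (fun x : ℝ => (1 - Complex.exp (-b * x ^ 2)) / x ^ 2)
      (Set.Ioi 0) := by
  have hdom : ∀ᵐ x : ℝ ∂volume.restrict (Set.Ioi 0),
      ‖(1 - Complex.exp (-b * x ^ 2)) / x ^ 2‖ ≤ (‖b‖ + 2) * (1 + x ^ 2)⁻¹ := by
    filter_upwards [ae_restrict_mem measurableSet_Ioi] with x hx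
    have hx : 0 < x := hx
    have h₁ := norm_one_sub_cexp_neg_mul_sq_le_norm hb x
    have h₂ := norm_one_sub_cexp_neg_mul_sq_le_two hb x
    rw [norm_div, norm_pow, Complex.norm_real, Real.norm_eq_abs, sq_abs, ← div_eq_mul_inv,
      div_le_div_iff₀ (by positivity) (by positivity)]
    nlinarith [mul_le_mul_of_nonneg_right h₂ (sq_nonneg x)]
  refine ((integrable_inv_one_add_sq.const_mul _).integrableOn).mono' ?_ hdom
  exact Measurable.aestronglyMeasurable (by fun_prop)

theorem hasDerivAt_one_sub_cexp_neg_mul_sq (b : ℂ) (x : ℝ) :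
    HasDerivAt (fun x : ℝ => 1 - Complex.exp (-b * x ^ 2))
      (2 * b * x * Complex.exp (-b * x ^ 2)) x := by
  refine (((((hasDerivAt_id x).ofReal_comp.pow 2).const_mul (-b)).cexp).const_sub 1).congr_deriv ?_
  simp only [id, Pi.pow_apply]
  push_cast
  ring

theorem tendsto_one_sub_cexp_neg_mul_sq_div_nhdsGT (hb : 0 ≤ b.re) :
    Tendsto (fun x : ℝ => (1 - Complex.exp (-b * x ^ 2)) / x) (𝓝[>] 0) (𝓝 0) := by
  have hlim : Tendsto (fun x : ℝ => ‖b‖ * x) (𝓝[>] 0) (𝓝 0) :=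
    (Continuous.tendsto' (by fun_prop) 0 0 (mul_zero _)).mono_left nhdsWithin_le_nhds
  refine squeeze_zero_norm' ?_ hlim
  filter_upwards [self_mem_nhdsWithin] with x (hx : 0 < x)
  have h := norm_one_sub_cexp_neg_mul_sq_le_norm hb x
  rw [norm_div, Complex.norm_real, Real.norm_of_nonneg hx.le, div_le_iff₀ hx]
  linarith

theorem tendsto_one_sub_cexp_neg_mul_sq_div_atTop (hb : 0 ≤ b.re) :
    Tendsto (fun x : ℝ => (1 - Complex.exp (-b * x ^ 2)) / x) atTop (𝓝 0) := by
  refine squeeze_zero_norm' ?_ (tendsto_const_nhds (x := (2 : ℝ)).div_atTop tendsto_id)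
  filter_upwards [eventually_gt_atTop 0] with x hx
  rw [norm_div, Complex.norm_real, Real.norm_of_nonneg hx.le]
  exact div_le_div_of_nonneg_right (norm_one_sub_cexp_neg_mul_sq_le_two hb x) hx.le

theorem mul_ofReal_div_cpow_one_half {r : ℝ} (hr : 0 < r) (hb : 0 < b.re) :
    b * (r / b) ^ (1 / 2 : ℂ) = √r * b.sqrt := by
  have hb₀ : b ≠ 0 := fun h => hb.ne' (by simp [h])
  have hlog : Complex.log (r / b) = 2 * Real.log √r - Complex.log b := by
    rw [div_eq_mul_inv, Complex.log_ofReal_mul hr (inv_ne_zero hb₀),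
      Complex.log_inv b (Complex.slitPlane_arg_ne_pi (.inl hb)), Real.log_sqrt hr.le]
    push_cast
    ring
  calc b * (r / b) ^ (1 / 2 : ℂ)
      = Complex.exp (Complex.log b) *
          Complex.exp ((2 * Real.log √r - Complex.log b) * (1 / 2)) := by
        rw [Complex.exp_log hb₀, Complex.cpow_def_of_ne_zero
          (div_ne_zero (Complex.ofReal_ne_zero.2 hr.ne') hb₀), hlog]
    _ = Complex.exp (Real.log √r) * Complex.exp (Complex.log b / 2) := by
        rw [← Complex.exp_add, ← Complex.exp_add]
        ring_nf
    _ = √r * b.sqrt := by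
        rw [sqrt_eq_exp hb₀, ← Complex.ofReal_exp, Real.exp_log (Real.sqrt_pos.2 hr)]

theorem integral_one_sub_cexp_neg_mul_sq_div_sq (hb : 0 < b.re) :
    ∫ x : ℝ in Set.Ioi 0, (1 - Complex.exp (-b * x ^ 2)) / x ^ 2 = √Real.pi * b.sqrt := by
  have hv : ∀ x ∈ Set.Ioi (0 : ℝ), HasDerivAt (fun x : ℝ => -(x : ℂ)⁻¹) ((x : ℂ) ^ 2)⁻¹ x :=
    fun x hx => by
      simpa using ((hasDerivAt_inv (Complex.ofReal_ne_zero.2 (ne_of_gt hx))).neg).comp_ofReal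
  have hu'v : ∀ x ∈ Set.Ioi (0 : ℝ), 2 * b * x * Complex.exp (-b * x ^ 2) * -(x : ℂ)⁻¹ =
      -(2 * b) * Complex.exp (-b * x ^ 2) := fun x hx => by
    have hx : (x : ℂ) ≠ 0 := Complex.ofReal_ne_zero.2 (ne_of_gt hx)
    field_simp
  have hparts := integral_Ioi_mul_deriv_eq_deriv_mul
    (fun x _ => hasDerivAt_one_sub_cexp_neg_mul_sq b x) hv
    (integrableOn_one_sub_cexp_neg_mul_sq_div_sq hb.le)
    (((integrable_cexp_neg_mul_sq hb).const_mul (-(2 * b))).integrableOn.congr_fun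
      (fun x hx => (hu'v x hx).symm) measurableSet_Ioi)
    (a' := 0) (b' := 0)
    (by simpa [div_eq_mul_inv, Pi.mul_def] using
      (tendsto_one_sub_cexp_neg_mul_sq_div_nhdsGT hb.le).neg)
    (by simpa [div_eq_mul_inv, Pi.mul_def] using
      (tendsto_one_sub_cexp_neg_mul_sq_div_atTop hb.le).neg)
  rw [setIntegral_congr_fun measurableSet_Ioi hu'v,
    integral_const_mul, integral_gaussian_complex_Ioi hb] at hparts
  calc ∫ x : ℝ in Set.Ioi 0, (1 - Complex.exp (-b * x ^ 2)) / x ^ 2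
      = b * (Real.pi / b) ^ (1 / 2 : ℂ) := by
        simp only [div_eq_mul_inv] at hparts ⊢
        rw [hparts]
        ring
    _ = √Real.pi * b.sqrt := mul_ofReal_div_cpow_one_half Real.pi_pos hb

variable {ι : Type*} [Fintype ι]

theorem sum_mul_mul_re_one_sub_cexp_neg_mul_sq_div_sq_nonpos {Z : Matrix ι ι ℂ} {x : ℝ}
    (hexp : (Z.map fun z => (Complex.exp (-(x ^ 2 : ℝ) * z)).re).PosSemidef) {c : ι → ℝ}
    (hc : ∑ i, c i = 0) :
    ∑ i, ∑ j, c i * c j * ((1 - Complex.exp (-Z i j * x ^ 2)) / x ^ 2).re ≤ 0 := by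
  set M := Z.map fun z => (Complex.exp (-(x ^ 2 : ℝ) * z)).re with hM
  have hentry (i j : ι) : ((1 - Complex.exp (-Z i j * x ^ 2)) / x ^ 2).re =
      (1 - M i j) / x ^ 2 := by
    rw [← Complex.ofReal_pow, Complex.div_ofReal_re, hM, Matrix.map_apply, Complex.sub_re,
      Complex.one_re, neg_mul, neg_mul, mul_comm (Z i j)]
  calc ∑ i, ∑ j, c i * c j * ((1 - Complex.exp (-Z i j * x ^ 2)) / x ^ 2).re
      = (∑ i, ∑ j, c i * c j * (1 - M i j)) / x ^ 2 := by
        simp only [hentry, Finset.sum_div, mul_div_assoc]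
    _ ≤ 0 := div_nonpos_of_nonpos_of_nonneg (sum_mul_mul_one_sub_nonpos hexp hc) (sq_nonneg x)

theorem sum_mul_mul_re_sqrt_nonpos_of_re_pos {Z : Matrix ι ι ℂ}
    (hre : ∀ i j, 0 < (Z i j).re)
    (hexp : ∀ r : ℝ, 0 < r → (Z.map fun z => (Complex.exp (-r * z)).re).PosSemidef)
    {c : ι → ℝ} (hc : ∑ i, c i = 0) :
    ∑ i, ∑ j, c i * c j * (Z i j).sqrt.re ≤ 0 := by
  have hint (i j : ι) : IntegrableOn
      (fun x : ℝ => c i * c j * ((1 - Complex.exp (-Z i j * x ^ 2)) / x ^ 2).re) (Set.Ioi 0) :=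
    (integrableOn_one_sub_cexp_neg_mul_sq_div_sq (hre i j).le).re.const_mul _
  have hsqrt (i j : ι) : √Real.pi * (Z i j).sqrt.re =
      ∫ x : ℝ in Set.Ioi 0, ((1 - Complex.exp (-Z i j * x ^ 2)) / x ^ 2).re := by
    rw [← Complex.re_ofReal_mul, ← integral_one_sub_cexp_neg_mul_sq_div_sq (hre i j)]
    exact (integral_re (integrableOn_one_sub_cexp_neg_mul_sq_div_sq (hre i j).le)).symm
  refine nonpos_of_mul_nonpos_right ?_ (Real.sqrt_pos.2 Real.pi_pos)
  calc √Real.pi * ∑ i, ∑ j, c i * c j * (Z i j).sqrt.re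
      = ∑ i, ∑ j, ∫ x : ℝ in Set.Ioi 0,
          c i * c j * ((1 - Complex.exp (-Z i j * x ^ 2)) / x ^ 2).re := by
        simp only [Finset.mul_sum, integral_const_mul, ← hsqrt, mul_left_comm]
    _ = ∫ x : ℝ in Set.Ioi 0,
          ∑ i, ∑ j, c i * c j * ((1 - Complex.exp (-Z i j * x ^ 2)) / x ^ 2).re := by
        rw [integral_finsetSum _ fun i _ =>
          integrable_finsetSum _ fun j _ => hint i j]
        exact Finset.sum_congr rfl fun i _ =>
          (integral_finsetSum _ fun j _ => hint i j).symm
    _ ≤ 0 := setIntegral_nonpos measurableSet_Ioi fun x (hx : 0 < x) =>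
        sum_mul_mul_re_one_sub_cexp_neg_mul_sq_div_sq_nonpos (hexp (x ^ 2) (by positivity)) hc

theorem sum_mul_mul_re_sqrt_nonpos {Z : Matrix ι ι ℂ}
    (hre : ∀ i j, 0 ≤ (Z i j).re)
    (hexp : ∀ r : ℝ, 0 < r → (Z.map fun z => (Complex.exp (-r * z)).re).PosSemidef)
    {c : ι → ℝ} (hc : ∑ i, c i = 0) :
    ∑ i, ∑ j, c i * c j * (Z i j).sqrt.re ≤ 0 := by
  have hshift : ∀ᶠ s : ℝ in 𝓝[>] 0, ∑ i, ∑ j, c i * c j * (Z i j + s).sqrt.re ≤ 0 := by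
    filter_upwards [self_mem_nhdsWithin] with s (hs : 0 < s)
    refine sum_mul_mul_re_sqrt_nonpos_of_re_pos (Z := Z.map (· + (s : ℂ)))
      (fun i j => add_pos_of_nonneg_of_pos (hre i j) hs) (fun r hr => ?_) hc
    convert (hexp r hr).smul (Real.exp_pos (-r * s)).le using 1
    ext i j
    have hfactor : Complex.exp (-r * (Z i j + s)) =
        (Real.exp (-r * s) : ℂ) * Complex.exp (-r * Z i j) := by
      rw [Complex.ofReal_exp, ← Complex.exp_add]
      push_cast
      ring_nf
    simp only [Matrix.map_apply, Matrix.smul_apply, smul_eq_mul, hfactor, Complex.re_ofReal_mul]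
  have hcont : Continuous fun s : ℝ => ∑ i, ∑ j, c i * c j * (Z i j + s).sqrt.re := by
    simp only [Complex.sqrt, Complex.cpow_inv_two_re]
    fun_prop
  simpa using le_of_tendsto ((hcont.tendsto 0).mono_left nhdsWithin_le_nhds) hshift

end SquareRoot

section Snowflake

theorem IsMetric.isQuasimetric {X : Type*} {d : X → X → ℝ} (hd : IsMetric d) :
    IsQuasimetric d := by
  have ⟨m, hm⟩ := hd
  exact ⟨fun x y => by rw [← hm, ← hm, m.dist_comm], 1, one_pos, d, hd, fun x y => by simp⟩

namespace IsQuasimetric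

variable {X : Type*} {d : X → X → ℝ}

theorem eq_zero_iff (hd : IsQuasimetric d) {x y : X} : d x y = 0 ↔ x = y := by
  obtain ⟨-, K, hK, ρ, ⟨m, hm⟩, hcomp⟩ := hd
  obtain ⟨hlower, hupper⟩ := hcomp x y
  constructor
  · intro h
    have : m.dist x y ≤ 0 := by
      rw [hm]
      exact nonpos_of_mul_nonpos_right (hlower.trans h.le) (one_div_pos.2 hK)
    exact dist_le_zero.1 this
  · rintro rfl
    have hρ : ρ x x = 0 := by rw [← hm, m.dist_self]
    rw [hρ, mul_zero] at hlower hupper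
    exact le_antisymm hupper hlower

theorem nonneg (hd : IsQuasimetric d) (x y : X) : 0 ≤ d x y := by
  obtain ⟨-, K, hK, ρ, ⟨m, hm⟩, hcomp⟩ := hd
  refine le_trans (mul_nonneg (one_div_nonneg.2 hK.le) ?_) (hcomp x y).1
  rw [← hm]
  exact dist_nonneg

theorem distFactor_nonneg (hd : IsQuasimetric d) (x y : OnePoint X) : 0 ≤ distFactor d x y := by
  induction x using OnePoint.rec <;> induction y using OnePoint.rec
  case coe.coe x y => exact hd.nonneg x y
  all_goals exact zero_le_one

theorem distFactor_pos (hd : IsQuasimetric d) {x y : OnePoint X} (hxy : x ≠ y) :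
    0 < distFactor d x y := by
  induction x using OnePoint.rec <;> induction y using OnePoint.rec
  case coe.coe x y =>
    exact (hd.nonneg x y).lt_of_ne' fun h => hxy (congrArg _ (hd.eq_zero_iff.1 h))
  all_goals exact one_pos

theorem crossRatio_pos (hd : IsQuasimetric d) {x y z w : OnePoint X} (hxz : x ≠ z) (hyw : y ≠ w)
    (hxw : x ≠ w) (hyz : y ≠ z) : 0 < crossRatio d x y z w := by
  rw [crossRatio, if_neg (not_or.2 ⟨hxz, hyw⟩)]
  exact div_pos (mul_pos (hd.distFactor_pos hxz) (hd.distFactor_pos hyw))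
    (mul_pos (hd.distFactor_pos hxw) (hd.distFactor_pos hyz))

end IsQuasimetric

theorem Separated.ne {X : Type*} {d : X → X → ℝ} {q : X} {u : ℝ≥0 → ℝ} (hd : IsQuasimetric d)
    (hu : ∀ r, 0 ≤ u r) {x y : OnePoint X} (hxy : Separated d q u x y) : x ≠ y := by
  rintro rfl
  induction x using OnePoint.rec with
  | infty => exact hxy
  | coe x => exact ((hu _).trans_lt hxy).ne' (hd.eq_zero_iff.2 rfl)

variable {X Y : Type*} {dX : X → X → ℝ} {dY : Y → Y → ℝ} {T : X → Y} {α : ℝ}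

theorem injective_of_eq_rpow (hα : α ≠ 0) (hX : IsQuasimetric dX) (hY : IsQuasimetric dY)
    (hT : ∀ x y, dY (T x) (T y) = dX x y ^ α) : Function.Injective T := fun x y hxy =>
  hX.eq_zero_iff.1 <| (Real.rpow_eq_zero (hX.nonneg x y) hα).1 <| by
    rw [← hT, hY.eq_zero_iff.2 hxy]

theorem distFactor_map_eq_rpow (hT : ∀ x y, dY (T x) (T y) = dX x y ^ α) (x y : OnePoint X) :
    distFactor dY (x.map T) (y.map T) = distFactor dX x y ^ α := by
  induction x using OnePoint.rec <;> induction y using OnePoint.rec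
  case coe.coe x y => exact hT x y
  all_goals exact (Real.one_rpow α).symm

theorem crossRatio_map_eq_rpow (hα : α ≠ 0) (hX : IsQuasimetric dX) (hY : IsQuasimetric dY)
    (hT : ∀ x y, dY (T x) (T y) = dX x y ^ α) (x y z w : OnePoint X) :
    crossRatio dY (x.map T) (y.map T) (z.map T) (w.map T) = crossRatio dX x y z w ^ α := by
  have hinj : Function.Injective (OnePoint.map T) :=
    Option.map_injective (injective_of_eq_rpow hα hX hY hT)
  have hiff : x.map T = z.map T ∨ y.map T = w.map T ↔ x = z ∨ y = w :=
    or_congr hinj.eq_iff hinj.eq_iff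
  have hnonneg := hX.distFactor_nonneg
  by_cases h : x = z ∨ y = w
  · rw [crossRatio, crossRatio, if_pos (hiff.2 h), if_pos h, Real.zero_rpow hα]
  · rw [crossRatio, crossRatio, if_neg (hiff.not.2 h), if_neg h]
    simp only [distFactor_map_eq_rpow hT, Real.div_rpow, Real.mul_rpow, mul_nonneg, hnonneg]

theorem isAMMapAtInfinity_of_eq_rpow (hα : 0 < α) (hX : IsQuasimetric dX) (hY : IsQuasimetric dY)
    (hunbounded : ∀ C : ℝ, ∃ x y, C < dX x y) (hT : ∀ x y, dY (T x) (T y) = dX x y ^ α) (q : X) :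
    IsAMMapAtInfinity dX q dY (T q) (OnePoint.map T) where
  quasimetric_source := hX
  quasimetric_target := hY
  unbounded_source := hunbounded
  unbounded_target C := by
    obtain ⟨x, y, hxy⟩ := hunbounded (|C| ^ α⁻¹)
    refine ⟨T x, T y, (le_abs_self C).trans_lt ?_⟩
    rw [hT]
    exact (Real.rpow_inv_lt_iff_of_pos (abs_nonneg C) (hX.nonneg x y) hα).1 hxy
  map_origin := OnePoint.map_some T q
  map_infty := OnePoint.map_infty T
  crossRatio_lt := by
    have hinj : Function.Injective (OnePoint.map T) :=
      Option.map_injective (injective_of_eq_rpow hα.ne' hX hY hT)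
    refine ⟨0, (Homeomorph.mulLeft₀ (2 : ℝ≥0) two_ne_zero).trans
      (NNReal.orderIsoRpow α hα).toHomeomorph, ⟨monotone_const, by simp⟩,
      fun x y z w hsep hxw hyz => ⟨hinj.ne hxw, hinj.ne hyz, ?_⟩⟩
    have hne : [x, y, z, w].Pairwise (· ≠ ·) := hsep.imp (Separated.ne hX fun _ => le_rfl)
    simp only [List.pairwise_cons, List.mem_cons, List.not_mem_nil, or_false, forall_eq_or_imp,
      forall_eq] at hne
    obtain ⟨⟨-, hxz, -⟩, ⟨-, hyw⟩, -⟩ := hne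
    have hpos := hX.crossRatio_pos hxz hyw hxw hyz
    calc crossRatio dY (x.map T) (y.map T) (z.map T) (w.map T)
        = crossRatio dX x y z w ^ α := crossRatio_map_eq_rpow hα.ne' hX hY hT x y z w
      _ < (2 * crossRatio dX x y z w) ^ α := by gcongr; linarith
      _ = ((2 * (crossRatio dX x y z w).toNNReal) ^ α : ℝ≥0) := by
        rw [NNReal.coe_rpow, NNReal.coe_mul, Real.coe_toNNReal _ hpos.le, NNReal.coe_ofNat]

end Snowflake

namespace Heis

open scoped ComplexConjugate

section Gauge

variable {E : Type u} [NormedAddCommGroup E]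

/-- The point `‖a‖² + it` of the closed right half-plane; the group norm is determined by it
through `N = √2 Re √(‖a‖² + it)`. -/
def complexGauge (g : Heis E) : ℂ := ⟨‖g.a‖ ^ 2, g.t⟩

theorem complexGauge_inv (g : Heis E) : complexGauge g⁻¹ = conj (complexGauge g) := by
  apply Complex.ext <;> simp [complexGauge]

theorem sq_N (g : Heis E) : N g ^ 2 = ‖complexGauge g‖ + ‖g.a‖ ^ 2 := by
  rw [N, Real.sq_sqrt (by positivity), complexGauge, Complex.norm_eq_sqrt_sq_add_sq]
  ring_nf

theorem N_eq_sqrt_two_mul_re_sqrt (g : Heis E) : N g = √2 * (complexGauge g).sqrt.re := by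
  have hN : 0 ≤ N g := Real.sqrt_nonneg _
  rw [Complex.sqrt, Complex.cpow_inv_two_re, ← Real.sqrt_mul zero_le_two,
    mul_div_cancel₀ _ two_ne_zero, ← Real.sqrt_sq hN, sq_N]
  rfl

theorem N_one : N (1 : Heis E) = 0 := by simp [N]

theorem N_inv (g : Heis E) : N g⁻¹ = N g := by simp [N]

theorem two_mul_sq_norm_le_sq_N (g : Heis E) : 2 * ‖g.a‖ ^ 2 ≤ N g ^ 2 := by
  have hre : ‖g.a‖ ^ 2 ≤ ‖complexGauge g‖ := Complex.re_le_norm (complexGauge g)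
  rw [sq_N]
  linarith

theorem eq_one_of_N_eq_zero {g : Heis E} (hg : N g = 0) : g = 1 := by
  have hsum : ‖complexGauge g‖ + ‖g.a‖ ^ 2 = 0 := by rw [← sq_N, hg, sq, zero_mul]
  have hζ : complexGauge g = 0 :=
    norm_eq_zero.1 ((add_eq_zero_iff_of_nonneg (norm_nonneg _) (sq_nonneg _)).1 hsum).1
  ext
  · have ha : ‖g.a‖ ^ 2 = 0 := congrArg Complex.re hζ
    simpa using ha
  · exact congrArg Complex.im hζ

@[fun_prop]
theorem continuous_a : Continuous (a : Heis E → E) :=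
  continuous_fst.comp (continuous_induced_dom (f := fun g : Heis E => (g.a, g.t)))

@[fun_prop]
theorem continuous_t : Continuous (t : Heis E → ℝ) :=
  continuous_snd.comp (continuous_induced_dom (f := fun g : Heis E => (g.a, g.t)))

end Gauge

variable {E : Type u} [NormedAddCommGroup E] [InnerProductSpace ℂ E]

theorem complexGauge_mul (g h : Heis E) :
    complexGauge (g * h) = complexGauge g + complexGauge h + 2 * inner ℂ g.a h.a := by
  apply Complex.ext
  · have hnorm : ‖g.a + h.a‖ ^ 2 = ‖g.a‖ ^ 2 + ‖h.a‖ ^ 2 + 2 * (inner ℂ g.a h.a).re := by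
      rw [norm_add_sq (𝕜 := ℂ), RCLike.re_eq_complex_re]
      ring
    simpa [complexGauge] using hnorm
  · simp [complexGauge, Omega]

theorem complexGauge_mul_inv (g h : Heis E) :
    complexGauge (g * h⁻¹) = complexGauge g + conj (complexGauge h) - 2 * inner ℂ g.a h.a := by
  rw [complexGauge_mul, complexGauge_inv, inv_a, inner_neg_right]
  ring

theorem sq_N_mul_le (g h : Heis E) : N (g * h) ^ 2 ≤ N g ^ 2 + N h ^ 2 + 4 * (‖g.a‖ * ‖h.a‖) := by
  have hgauge : ‖complexGauge (g * h)‖ ≤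
      ‖complexGauge g‖ + ‖complexGauge h‖ + 2 * (‖g.a‖ * ‖h.a‖) := by
    calc ‖complexGauge (g * h)‖
        ≤ ‖complexGauge g‖ + ‖complexGauge h‖ + ‖2 * inner ℂ g.a h.a‖ := by
          rw [complexGauge_mul]
          exact norm_add₃_le
      _ ≤ ‖complexGauge g‖ + ‖complexGauge h‖ + 2 * (‖g.a‖ * ‖h.a‖) := by
          rw [norm_mul, Complex.norm_ofNat]
          gcongr
          exact norm_inner_le_norm _ _
  have hnorm : ‖(g * h).a‖ ^ 2 ≤ (‖g.a‖ + ‖h.a‖) ^ 2 := by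
    gcongr
    exact norm_add_le _ _
  rw [sq_N, sq_N, sq_N]
  linarith

theorem N_mul_le (g h : Heis E) : N (g * h) ≤ N g + N h := by
  have hNg : 0 ≤ N g := Real.sqrt_nonneg _
  have hNh : 0 ≤ N h := Real.sqrt_nonneg _
  have hprod : 2 * (‖g.a‖ * ‖h.a‖) ≤ N g * N h := by
    refine le_of_sq_le_sq ?_ (mul_nonneg hNg hNh)
    calc (2 * (‖g.a‖ * ‖h.a‖)) ^ 2 = (2 * ‖g.a‖ ^ 2) * (2 * ‖h.a‖ ^ 2) := by ring
      _ ≤ N g ^ 2 * N h ^ 2 := by gcongr <;> exact two_mul_sq_norm_le_sq_N _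
      _ = (N g * N h) ^ 2 := by ring
  refine le_of_sq_le_sq ?_ (add_nonneg hNg hNh)
  calc N (g * h) ^ 2 ≤ N g ^ 2 + N h ^ 2 + 4 * (‖g.a‖ * ‖h.a‖) := sq_N_mul_le g h
    _ ≤ N g ^ 2 + N h ^ 2 + 2 * (N g * N h) := by linarith
    _ = (N g + N h) ^ 2 := by ring

variable (E) in
/-- The gauge `N` as a group norm on the Heisenberg group. -/
noncomputable def groupNorm : GroupNorm (Heis E) where
  toFun := N
  map_one' := N_one
  mul_le' := N_mul_le
  inv' := N_inv
  eq_one_of_map_eq_zero' _ := eq_one_of_N_eq_zero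

theorem dN_self (g : Heis E) : dN g g = 0 := by rw [dN, mul_inv_cancel, N_one]

theorem dN_comm (g h : Heis E) : dN g h = dN h g := by
  rw [dN, ← N_inv, mul_inv_rev, inv_inv, dN]

theorem dN_triangle (g h k : Heis E) : dN g k ≤ dN g h + dN h k := by
  simpa [dN, mul_assoc] using N_mul_le (g * h⁻¹) (h * k⁻¹)

theorem dN_mul_right (g h k : Heis E) : dN (g * k) (h * k) = dN g h := by
  rw [dN, dN, mul_inv_rev, mul_assoc, mul_inv_cancel_left]

theorem isMetric_dN : IsMetric (dN (E := E)) :=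
  ⟨{ dist := dN
     dist_self := dN_self
     dist_comm := dN_comm
     dist_triangle := dN_triangle
     eq_of_dist_eq_zero := fun h => mul_inv_eq_one.1 (eq_one_of_N_eq_zero h) },
   fun _ _ => rfl⟩

theorem dN_mk_zero_one (t : ℝ) : dN (⟨0, t⟩ : Heis E) 1 = √|t| := by
  simp [dN, N, Real.sqrt_sq_eq_abs]

theorem unbounded_dN (C : ℝ) : ∃ g h : Heis E, C < dN g h := by
  refine ⟨⟨0, C ^ 2 + 1⟩, 1, ?_⟩
  rw [dN_mk_zero_one, abs_of_pos (by positivity)]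
  exact Real.lt_sqrt_of_sq_lt (lt_add_one _)

theorem continuous_dN : Continuous fun p : Heis E × Heis E => dN p.1 p.2 := by
  simp only [dN, N, mul_a, mul_t, inv_a, inv_t, Omega]
  fun_prop

theorem posSemidef_re_exp_complexGauge {ι : Type*} [Finite ι] (x : ι → Heis E) {r : ℝ}
    (hr : 0 ≤ r) :
    (Matrix.of fun i j =>
      (Complex.exp (-r * complexGauge (x i * (x j)⁻¹))).re).PosSemidef := by
  open scoped ComplexOrder in
  have hgram : ((2 * r : ℂ) • Matrix.gram ℂ fun i => (x i).a).PosSemidef :=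
    (Matrix.posSemidef_gram ℂ _).smul (by exact_mod_cast mul_nonneg zero_le_two hr)
  convert posSemidef_map_re (posSemidef_exp_add_conj_add hgram fun i => -r * complexGauge (x i))
    using 1
  ext i j
  simp only [Matrix.of_apply, Matrix.map_apply, Matrix.smul_apply, Matrix.gram_apply,
    complexGauge_mul_inv, map_mul, map_neg, Complex.conj_ofReal, smul_eq_mul]
  ring_nf

theorem isCondNegType_dN : IsCondNegType (dN (E := E)) where
  continuous := continuous_dN
  diag := dN_self
  symm x y := dN_comm y x
  sum_nonpos n x c hc := by
    have hre (i j : Fin n) : 0 ≤ (complexGauge (x i * (x j)⁻¹)).re := sq_nonneg _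
    have hsqrt := sum_mul_mul_re_sqrt_nonpos hre
      (fun r hr => posSemidef_re_exp_complexGauge x hr.le) hc
    calc ∑ i, ∑ j, c i * c j * dN (x i) (x j)
        = √2 * ∑ i, ∑ j, c i * c j * (complexGauge (x i * (x j)⁻¹)).sqrt.re := by
          simp only [dN, N_eq_sqrt_two_mul_re_sqrt, Finset.mul_sum, mul_left_comm]
      _ ≤ 0 := mul_nonpos_of_nonneg_of_nonpos (Real.sqrt_nonneg 2) hsqrt

end Heis

theorem mainTheorem6_general {E : Type u} [NormedAddCommGroup E] [InnerProductSpace ℂ E] :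
    (∃ ν : GroupNorm (Heis E), ∀ g, ν g = Heis.N g) ∧
    IsMetric (Heis.dN (E := E)) ∧
    (∀ g h k : Heis E, Heis.dN (g * k) (h * k) = Heis.dN g h) ∧
    IsCondNegType (Heis.dN (E := E)) ∧
    ∃ (H : Type u) (_ : NormedAddCommGroup H) (_ : InnerProductSpace ℝ H) (_ : CompleteSpace H)
      (T : Heis E → H),
      (∀ g h : Heis E, dist (T g) (T h) = Real.sqrt (Heis.dN g h)) ∧
      ∀ q : Heis E, IsAMMapAtInfinity (Heis.dN (E := E)) q (fun x y : H => dist x y) (T q)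
        (OnePoint.map T) := by
  refine ⟨⟨Heis.groupNorm E, fun _ => rfl⟩, Heis.isMetric_dN, Heis.dN_mul_right,
    Heis.isCondNegType_dN, ?_⟩
  obtain ⟨H, _, _, _, T, hT⟩ := (Heis.isCondNegType_dN (E := E)).exists_embedding 1
  have hsnowflake (g h : Heis E) : dist (T g) (T h) = Heis.dN g h ^ (1 / 2 : ℝ) :=
    (hT g h).trans (Real.sqrt_eq_rpow _)
  have hH : IsMetric fun x y : H => dist x y := ⟨inferInstance, fun _ _ => rfl⟩
  exact ⟨H, inferInstance, inferInstance, inferInstance, T, hT,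
    isAMMapAtInfinity_of_eq_rpow one_half_pos Heis.isMetric_dN.isQuasimetric hH.isQuasimetric
      Heis.unbounded_dN hsnowflake⟩

theorem mainTheorem6 {E : Type u} [NormedAddCommGroup E] [InnerProductSpace ℂ E] [CompleteSpace E]
    (hE : ¬ FiniteDimensional ℂ E) :
    -- `N` is a group norm and `d_N` is a right-invariant metric
    (∃ ν : GroupNorm (Heis E), ∀ g, ν g = Heis.N g) ∧
    IsMetric (Heis.dN (E := E)) ∧
    (∀ g h k : Heis E, Heis.dN (g * k) (h * k) = Heis.dN g h) ∧
    -- `d_N` is conditionally of negative type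
    IsCondNegType (Heis.dN (E := E)) ∧
    -- `(H_Ω, √d_N)` embeds isometrically into a real Hilbert space, by an AM-map on `(H_Ω, d_N)`
    ∃ (H : Type u) (_ : NormedAddCommGroup H) (_ : InnerProductSpace ℝ H) (_ : CompleteSpace H)
      (T : Heis E → H),
      (∀ g h : Heis E, dist (T g) (T h) = Real.sqrt (Heis.dN g h)) ∧
      ∀ q : Heis E, IsAMMapAtInfinity (Heis.dN (E := E)) q (fun x y : H => dist x y) (T q)
        (OnePoint.map T) :=
  mainTheorem6_general
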